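/- Let $T\ge 1$ be an integer, let $\mathsf X\subset\mathbb R^{d}$, and let $X_0,\dots,X_{T-1}$ be $\mathsf X$-valued random variables on a probability space, with joint law $\mathsf P_X$. For a probability law $\mathsf P_Z$ of a process $Z_0,\dots,Z_{T-1}$, the dependency matrix $\Gamma_{\mathsf{dep}}(\mathsf P_Z)=(\Gamma_{ij})_{i,j=0}^{T-1}\in\mathbb R^{T\times T}$ is given by $\Gamma_{ii}=1$, by $\Gamma_{ij}=0$ for $i>j$, and, for $i<j$, by $$\Gamma_{ij}=\sqrt{2\sup_{A}\big\|\mathsf P_{Z_{j:T-1}}(\cdot\mid A)-\mathsf P_{Z_{j:T-1}}\big\|_{\mathsf{TV}}},$$ where $A$ ranges over the events of positive probability in the $\sigma$-algebra generated by $Z_0,\dots,Z_i$, $Z_{j:T-1}=(Z_j,\dots,Z_{T-1})$, and $\|\mu-\nu\|_{\mathsf{TV}}=\sup_B|\mu(B)-\nu(B)|$ over measurable sets $B$. For a matrix $M$, $\|M\|_{\mathsf{op}}$ denotes its largest singular value. Proposition. Fix $C>0$ and $\alpha\in[1,2]$. Let $g:\mathsf X\to\mathbb R$ be a non-negative measurable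 function such that $\mathbb E\,g^2(X_t)<\infty$ for all $t$ and $$\mathbb E\left[\frac1T\sum_{t=0}^{T-1}g^2(X_t)\right]\le C\left(\mathbb E\left[\frac1T\sum_{t=0}^{T-1}g(X_t)\right]\right)^{\alpha}.$$ If $\alpha=2$, assume in addition that $\sum_{t=0}^{T-1}\mathbb E\,g(X_t)>0$. Then $$\mathbf P\left(\sum_{t=0}^{T-1}g(X_t)\le\frac12\sum_{t=0}^{T-1}\mathbb E\,g(X_t)\right)\le\exp\left(-\frac{T}{8C\,\|\Gamma_{\mathsf{dep}}(\mathsf P_X)\|_{\mathsf{op}}^2}\left(\frac1T\sum_{t=0}^{T-1}\mathbb E\,g(X_t)\right)^{2-\alpha}\right).$$ -/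

import Mathlib

/-- Total-variation distance `sup_A |μ(A) - ν(A)|`, the supremum over all measurable sets. -/
noncomputable def tvDist {E : Type*} [MeasurableSpace E] (μ ν : MeasureTheory.Measure E) : ℝ :=
  ⨆ A : {A : Set E // MeasurableSet A}, |μ.real A.1 - ν.real A.1|

/-- The law of `(Z_j, …, Z_{T-1})` when `(Z_0, …, Z_{T-1})` has law `μ`. -/
noncomputable def tailLaw {T : ℕ} {E : Type*} [MeasurableSpace E]
    (μ : MeasureTheory.Measure (Fin T → E)) (j : Fin T) :
    MeasureTheory.Measure (Set.Ici j → E) :=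
  μ.map fun z k => z k.1

/-- `sup_A ‖P_{Z_{j:T-1}}(· | A) - P_{Z_{j:T-1}}‖_TV`, where `A` ranges over the events of positive
probability in the σ-algebra generated by `Z_0, …, Z_i`, for a process with law `μ`. -/
noncomputable def depCoeff {T : ℕ} {E : Type*} [MeasurableSpace E]
    (μ : MeasureTheory.Measure (Fin T → E)) (i j : Fin T) : ℝ :=
  ⨆ A : {A : Set (Fin T → E) //
      @MeasurableSet _ (MeasureTheory.cylinderEvents (Set.Iic i)) A ∧ μ A ≠ 0},
    tvDist (tailLaw (ProbabilityTheory.cond μ A.1) j) (tailLaw μ j)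

/-- The (upper-triangular) dependency matrix of a process with law `μ`. -/
noncomputable def depMatrix {T : ℕ} {E : Type*} [MeasurableSpace E]
    (μ : MeasureTheory.Measure (Fin T → E)) : Matrix (Fin T) (Fin T) ℝ :=
  Matrix.of fun i j =>
    if i < j then Real.sqrt (2 * depCoeff μ i j) else if i = j then 1 else 0

/-- Largest singular value of a real matrix: its operator norm on Euclidean space. -/
noncomputable def matOpNorm {T : ℕ} (M : Matrix (Fin T) (Fin T) ℝ) : ℝ :=
  ‖Matrix.toEuclideanCLM (𝕜 := ℝ) M‖

/-! The event is treated as a change of measure. Let `q` be the law `p` of the path conditioned on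
`∑ g ≤ s`; its relative entropy with respect to `p` is `-log p(∑ g ≤ s)`, and under `q` the sum has
mean at most `s`. A transport inequality of Samson type, `E_p ∑ g - E_q ∑ g ≤ ‖Γ‖ √(2 Ent(q|p))
√(E_p ∑ g²)`, therefore bounds the probability from above. With `s` half the mean and the moment
hypothesis, squaring gives the claim.

The transport inequality is proved on a finite alphabet without couplings. For a coordinate `j`, let
`N k` be the law of `Z_j` when the first `k` coordinates follow `q` and the others are drawn from
the conditional law under `p`, so that `N 0` and `N T` are the two marginals. The defect `(a - b)₊ /
√a` obeys a triangle inequality (`sqrtDefect_triangle`), so it suffices to control each step `N k →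
N (k+1)`. Such a step discloses one coordinate through a kernel whose rows are `Γ_kj²`-close in
total variation, and its squared defect is at most `Γ_kj²` times twice the entropy increment
(`sum_sqrtDefect_mixedMass_le`). Cauchy–Schwarz over the alphabet leaves the bilinear form of `Γ` in
the square roots of the doubled entropy increments and the `L²` norms of the `g(Z_j)`.

General `g` is approximated from below by functions with finitely many values. These remain
functions of single coordinates, so the dependency matrix of the original process still applies. -/

open Finset

/-! ### The one-sided defect and its scalar inequalities. -/

/-- One-sided distance between the densities `a` and `b`, normalised by `√a`. -/
noncomputable def sqrtDefect (a b : ℝ) : ℝ := max (a - b) 0 / √a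

theorem sqrtDefect_nonneg (a b : ℝ) : 0 ≤ sqrtDefect a b :=
  div_nonneg (le_max_right _ _) (Real.sqrt_nonneg _)

theorem sub_le_sqrt_mul_sqrtDefect {a b : ℝ} (ha : 0 ≤ a) (hb : 0 ≤ b) :
    a - b ≤ √a * sqrtDefect a b := by
  unfold sqrtDefect
  rcases ha.eq_or_lt with rfl | h
  · simpa using hb
  · rw [mul_div_cancel₀ _ (Real.sqrt_pos.2 h).ne']
    exact le_max_left _ _

theorem sqrtDefect_self (a : ℝ) : sqrtDefect a a = 0 := by simp [sqrtDefect]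

/-- Where the defect is non-zero it equals `√a - c / √a`, which increases with `a`. -/
theorem sqrtDefect_mono {a b c : ℝ} (ha : 0 ≤ a) (hc : 0 ≤ c) (hab : a ≤ b) :
    sqrtDefect a c ≤ sqrtDefect b c := by
  rcases ha.eq_or_lt with rfl | h
  · simpa [sqrtDefect] using sqrtDefect_nonneg b c
  rcases le_total a c with hac | hac
  · have : sqrtDefect a c = 0 := by simp [sqrtDefect, hac]
    rw [this]
    exact sqrtDefect_nonneg _ _
  · have hb : 0 < b := h.trans_le hab
    unfold sqrtDefect
    rw [max_eq_left (by linarith), max_eq_left (by linarith), sub_div, sub_div,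
      Real.div_sqrt, Real.div_sqrt]
    have h1 : √a ≤ √b := Real.sqrt_le_sqrt hab
    have h2 : c / √b ≤ c / √a := div_le_div_of_nonneg_left hc (Real.sqrt_pos.2 h) h1
    linarith

/-- Normalising by `√a` is not symmetric, but for `b ≤ a` replacing `√b` by `√a` only shrinks the
second term, and for `a ≤ b` monotonicity already suffices. -/
theorem sqrtDefect_triangle {a b c : ℝ} (ha : 0 ≤ a) (hb : 0 ≤ b) (hc : 0 ≤ c) :
    sqrtDefect a c ≤ sqrtDefect a b + sqrtDefect b c := by
  rcases le_total a b with hab | hab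
  · linarith [sqrtDefect_mono ha hc hab, sqrtDefect_nonneg a b]
  · rcases hb.eq_or_lt with rfl | h
    · have : sqrtDefect a c ≤ sqrtDefect a 0 := by
        unfold sqrtDefect
        gcongr
      linarith [sqrtDefect_nonneg 0 c]
    · have h1 : max (b - c) 0 / √a ≤ max (b - c) 0 / √b :=
        div_le_div_of_nonneg_left (le_max_right _ _) (Real.sqrt_pos.2 h) (Real.sqrt_le_sqrt hab)
      have h2 : max (a - c) 0 ≤ max (a - b) 0 + max (b - c) 0 :=
        max_le (by linarith [le_max_left (a - b) 0, le_max_left (b - c) 0])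
          (add_nonneg (le_max_right _ _) (le_max_right _ _))
      calc sqrtDefect a c ≤ (max (a - b) 0 + max (b - c) 0) / √a := by
            unfold sqrtDefect; gcongr
        _ = max (a - b) 0 / √a + max (b - c) 0 / √a := add_div _ _ _
        _ ≤ _ := add_le_add le_rfl h1

theorem sqrtDefect_le_sum (N : ℕ → ℝ) (hN : ∀ k, 0 ≤ N k) (n : ℕ) :
    sqrtDefect (N 0) (N n) ≤ ∑ k ∈ range n, sqrtDefect (N k) (N (k + 1)) := by
  induction n with
  | zero => simp [sqrtDefect_self]
  | succ n ih =>
    rw [sum_range_succ]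
    linarith [sqrtDefect_triangle (hN 0) (hN n) (hN (n + 1))]

theorem sqrtDefect_sq {a : ℝ} (ha : 0 ≤ a) (b : ℝ) :
    sqrtDefect a b ^ 2 = max (a - b) 0 ^ 2 / a := by
  rw [sqrtDefect, div_pow, Real.sq_sqrt ha]

/-- The scalar inequality behind the entropy bound. -/
theorem sq_max_sub_div_le {v w : ℝ} (hv : 0 ≤ v) (hw : 0 < w) :
    max (w - v) 0 ^ 2 / w ≤ 2 * (v * Real.log (v / w) - v + w) := by
  rcases hv.eq_or_lt with rfl | hv
  · rw [sub_zero, max_eq_left hw.le, sq, mul_div_cancel_right₀ _ hw.ne']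
    simp
    linarith
  rcases le_total v w with h | h
  · have hs : 1 ≤ w / v := (one_le_div hv).2 h
    -- With `s = w / v`, the bound `log s ≤ sinh (log s) = (s - s⁻¹) / 2` reproduces the quadratic
    -- `(w - v)² / w` exactly.
    have h1 := Real.self_le_sinh_iff.2 (Real.log_nonneg hs)
    rw [Real.sinh_log (by positivity), Real.log_div hw.ne' hv.ne'] at h1
    rw [max_eq_left (by linarith), Real.log_div hv.ne' hw.ne']
    have h2 : v * (Real.log w - Real.log v) ≤ v * ((w / v - (w / v)⁻¹) / 2) := by gcongr
    have h3 : v * ((w / v - (w / v)⁻¹) / 2) = (w - v ^ 2 / w) / 2 := by field_simp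
    have h4 : (w - v) ^ 2 / w = w - 2 * v + v ^ 2 / w := by field_simp; ring
    rw [h4]
    linarith
  · rw [max_eq_right (by linarith)]
    have h1 := Real.one_sub_inv_le_log_of_pos (div_pos hv hw)
    have h2 : v * (1 - (v / w)⁻¹) ≤ v * Real.log (v / w) := by gcongr
    have h3 : v * (1 - (v / w)⁻¹) = v - w := by field_simp
    simp
    linarith

/-! ### One disclosure step through a kernel. -/

section Step

variable {α β κ : Type*} [Fintype α] [Fintype β] [Fintype κ]

/-- Pushing `w` and `v`, which have the same marginal on `α`, through a kernel `K` whose rows are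
`c`-close in total variation. -/
theorem sum_sqrtDefect_sq_le (w v : α → β → ℝ) (K : α → β → κ → ℝ) {c : ℝ} (hc : 0 ≤ c)
    (hw : ∀ u x, 0 ≤ w u x) (hv : ∀ u x, 0 ≤ v u x) (hK : ∀ u x y, 0 ≤ K u x y)
    (hwv : ∀ u, ∑ x, w u x = ∑ x, v u x)
    (hTV : ∀ u x x', w u x ≠ 0 → v u x' ≠ 0 → ∑ y, max (K u x y - K u x' y) 0 ≤ c) :
    ∑ y, sqrtDefect (∑ u, ∑ x, w u x * K u x y) (∑ u, ∑ x, v u x * K u x y) ^ 2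
      ≤ c * ∑ u, ∑ x, max (w u x - v u x) 0 ^ 2 / w u x := by
  -- The positive and negative parts of `w - v` have the same mass `θ u` over each `u`, because the
  -- marginals agree.
  set δ : α → β → ℝ := fun u x => max (w u x - v u x) 0 with hδ
  set η : α → β → ℝ := fun u x => max (v u x - w u x) 0 with hη
  have hδ0 : ∀ u x, 0 ≤ δ u x := fun u x => le_max_right _ _
  have hη0 : ∀ u x, 0 ≤ η u x := fun u x => le_max_right _ _
  have hdiff : ∀ u x, w u x - v u x = δ u x - η u x := by
    intro u x
    simp only [hδ, hη]
    rcases le_total (w u x) (v u x) with h | h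
    · rw [max_eq_right (by linarith), max_eq_left (by linarith)]; ring
    · rw [max_eq_left (by linarith), max_eq_right (by linarith)]; ring
  have hδw : ∀ u x, δ u x ≠ 0 → w u x ≠ 0 := by
    intro u x h h0
    apply h
    simp [hδ, h0, hv u x]
  have hηv : ∀ u x, η u x ≠ 0 → v u x ≠ 0 := by
    intro u x h h0
    apply h
    simp [hη, h0, hw u x]
  set θ : α → ℝ := fun u => ∑ x, η u x with hθ
  have hθδ : ∀ u, ∑ x, δ u x = θ u := by
    intro u
    have := hwv u
    rw [← sub_eq_zero, ← sum_sub_distrib] at this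
    simp only [hdiff, sum_sub_distrib] at this
    linarith
  have hθ0 : ∀ u, 0 ≤ θ u := fun u => sum_nonneg fun x _ => hη0 u x
  -- The `η`-average of the positive parts of row differences: it is dominated by `K`, and its sum
  -- over `y` is at most `c` wherever `δ` is non-zero. If `θ u = 0`, division by zero makes it `0`.
  set s : α → β → κ → ℝ := fun u x y =>
    (∑ x', η u x' * max (K u x y - K u x' y) 0) / θ u with hs
  have hs0 : ∀ u x y, 0 ≤ s u x y := fun u x y =>
    div_nonneg (sum_nonneg fun x' _ => mul_nonneg (hη0 _ _) (le_max_right _ _)) (hθ0 u)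
  have hsK : ∀ u x y, s u x y ≤ K u x y := by
    intro u x y
    refine div_le_of_le_mul₀ (hθ0 u) (hK u x y) ?_
    rw [mul_comm, hθ, sum_mul]
    refine sum_le_sum fun x' _ => mul_le_mul_of_nonneg_left ?_ (hη0 _ _)
    exact max_le (by linarith [hK u x' y]) (hK u x y)
  have hsum : ∀ u x, δ u x ≠ 0 → ∑ y, s u x y ≤ c := by
    intro u x hx
    simp only [hs]
    rw [← sum_div]
    refine div_le_of_le_mul₀ (hθ0 u) hc ?_
    rw [sum_comm, mul_comm, hθ, sum_mul]
    refine sum_le_sum fun x' _ => ?_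
    rw [← mul_sum]
    by_cases h : η u x' = 0
    · simp [h]
    · exact mul_le_mul_of_nonneg_left (hTV u x x' (hδw u x hx) (hηv u x' h)) (hη0 _ _)
  have hkey : ∀ u y, ∑ x, w u x * K u x y - ∑ x, v u x * K u x y ≤ ∑ x, δ u x * s u x y := by
    intro u y
    have e1 : ∑ x, w u x * K u x y - ∑ x, v u x * K u x y
        = ∑ x, δ u x * K u x y - ∑ x, η u x * K u x y := by
      rw [← sum_sub_distrib, ← sum_sub_distrib]
      refine sum_congr rfl fun x _ => ?_
      rw [← sub_mul, ← sub_mul, hdiff]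
    rw [e1]
    rcases (hθ0 u).eq_or_lt with h | h
    · have z1 : ∀ x, η u x = 0 := fun x =>
        (sum_eq_zero_iff_of_nonneg fun x _ => hη0 u x).1 h.symm x (mem_univ x)
      have z2 : ∀ x, δ u x = 0 := fun x =>
        (sum_eq_zero_iff_of_nonneg fun x _ => hδ0 u x).1 ((hθδ u).trans h.symm) x (mem_univ x)
      simp [z1, z2]
    -- Multiplying by the common mass pairs each unit of `δ` with each unit of `η`, so that only
    -- differences of rows remain.
    · have e2 : θ u * (∑ x, δ u x * K u x y - ∑ x, η u x * K u x y)
          = ∑ x, δ u x * ∑ x', η u x' * (K u x y - K u x' y) := by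
        simp only [mul_sub, sum_sub_distrib, ← sum_mul]
        congr 1
        · rw [mul_sum]
          refine sum_congr rfl fun x _ => ?_
          simp only [hθ]
          ring
        · rw [hθδ u]
      have e3 : ∑ x, δ u x * ∑ x', η u x' * (K u x y - K u x' y)
          ≤ ∑ x, δ u x * (θ u * s u x y) := by
        refine sum_le_sum fun x _ => mul_le_mul_of_nonneg_left ?_ (hδ0 _ _)
        simp only [hs]
        rw [mul_div_cancel₀ _ h.ne']
        exact sum_le_sum fun x' _ => mul_le_mul_of_nonneg_left (le_max_left _ _) (hη0 _ _)
      refine le_of_mul_le_mul_left ?_ h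
      rw [e2, mul_sum]
      refine e3.trans_eq (sum_congr rfl fun x _ => by ring)
  have hm0 : ∀ y, 0 ≤ ∑ u, ∑ x, w u x * K u x y := fun y =>
    sum_nonneg fun u _ => sum_nonneg fun x _ => mul_nonneg (hw _ _) (hK _ _ _)
  have hpt : ∀ y, sqrtDefect (∑ u, ∑ x, w u x * K u x y) (∑ u, ∑ x, v u x * K u x y) ^ 2
      ≤ ∑ u, ∑ x, δ u x ^ 2 / w u x * s u x y := by
    intro y
    have hR : 0 ≤ ∑ u, ∑ x, δ u x ^ 2 / w u x * s u x y :=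
      sum_nonneg fun u _ => sum_nonneg fun x _ =>
        mul_nonneg (div_nonneg (sq_nonneg _) (hw _ _)) (hs0 _ _ _)
    rw [sqrtDefect_sq (hm0 y)]
    refine div_le_of_le_mul₀ (hm0 y) hR ?_
    have h1 : max (∑ u, ∑ x, w u x * K u x y - ∑ u, ∑ x, v u x * K u x y) 0
        ≤ ∑ u, ∑ x, δ u x * s u x y := by
      refine max_le ?_ (sum_nonneg fun u _ => sum_nonneg fun x _ =>
        mul_nonneg (hδ0 _ _) (hs0 _ _ _))
      rw [← sum_sub_distrib]
      exact sum_le_sum fun u _ => hkey u y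
    refine (pow_le_pow_left₀ (le_max_right _ _) h1 2).trans ?_
    simp only [← Fintype.sum_prod_type']
    rw [mul_comm]
    -- Weighted Cauchy–Schwarz: one factor `s` is absorbed by `K`, the other is kept. Summation over
    -- `y` then costs `c`.
    refine Finset.sum_sq_le_sum_mul_sum_of_sq_le_mul _ (fun i _ => mul_nonneg (hw _ _) (hK _ _ _))
      (fun i _ => mul_nonneg (div_nonneg (sq_nonneg _) (hw _ _)) (hs0 _ _ _)) fun i _ => ?_
    by_cases h : δ i.1 i.2 = 0
    · simp [h]
    · have hne := hδw _ _ h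
      have : w i.1 i.2 * K i.1 i.2 y * (δ i.1 i.2 ^ 2 / w i.1 i.2 * s i.1 i.2 y)
          = δ i.1 i.2 ^ 2 * (s i.1 i.2 y * K i.1 i.2 y) := by field_simp
      rw [this, mul_pow, sq (s _ _ _)]
      exact mul_le_mul_of_nonneg_left
        (mul_le_mul_of_nonneg_left (hsK _ _ _) (hs0 _ _ _)) (sq_nonneg _)
  refine (sum_le_sum fun y _ => hpt y).trans ?_
  rw [sum_comm, mul_sum]
  refine sum_le_sum fun u _ => ?_
  rw [sum_comm, mul_sum]
  refine sum_le_sum fun x _ => ?_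
  rw [← mul_sum, mul_comm c]
  by_cases h : δ u x = 0
  · simp only [hδ] at h ⊢
    simp [h]
  · exact mul_le_mul_of_nonneg_left (hsum u x h) (div_nonneg (sq_nonneg _) (hw _ _))

end Step

/-! ### Finite weights: images, densities, entropy and interpolating laws. -/

section Finite

variable {Ω α β κ : Type*}

open scoped Classical in
/-- The weights `p` restricted to `{Y = y}`. -/
noncomputable def restrictEq (p : Ω → ℝ) (Y : Ω → κ) (y : κ) (z : Ω) : ℝ :=
  if Y z = y then p z else 0

theorem restrictEq_nonneg {p : Ω → ℝ} (hp : ∀ z, 0 ≤ p z) (Y : Ω → κ) (y : κ) (z : Ω) :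
    0 ≤ restrictEq p Y y z := by
  unfold restrictEq
  split_ifs
  exacts [hp z, le_rfl]

theorem restrictEq_le {p : Ω → ℝ} (hp : ∀ z, 0 ≤ p z) (Y : Ω → κ) (y : κ) (z : Ω) :
    restrictEq p Y y z ≤ p z := by
  unfold restrictEq
  split_ifs
  exacts [le_rfl, hp z]

variable [Fintype Ω]

open scoped Classical in
/-- The mass at `a` of the image under `W` of the weights `p`. -/
noncomputable def pushMass (p : Ω → ℝ) (W : Ω → α) (a : α) : ℝ := ∑ z with W z = a, p z

theorem sum_pushMass_mul [Fintype α] (p : Ω → ℝ) (W : Ω → α) (F : α → ℝ) :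
    ∑ a, pushMass p W a * F a = ∑ z, p z * F (W z) := by
  classical
  rw [← sum_fiberwise (univ : Finset Ω) W]
  refine sum_congr rfl fun a _ => ?_
  rw [pushMass, sum_mul]
  refine sum_congr (by ext; simp) fun z hz => ?_
  rw [(mem_filter.1 hz).2]

theorem pushMass_nonneg {p : Ω → ℝ} (hp : ∀ z, 0 ≤ p z) (W : Ω → α) (a : α) :
    0 ≤ pushMass p W a := sum_nonneg fun z _ => hp z

theorem pushMass_eq_zero_iff {p : Ω → ℝ} (hp : ∀ z, 0 ≤ p z) {W : Ω → α} {a : α} :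
    pushMass p W a = 0 ↔ ∀ z, W z = a → p z = 0 := by
  classical
  rw [pushMass, sum_eq_zero_iff_of_nonneg fun z _ => hp z]
  simp

theorem pushMass_eq_zero_of_ac {p q : Ω → ℝ} (hp : ∀ z, 0 ≤ p z) (hq : ∀ z, 0 ≤ q z)
    (hpq : ∀ z, p z = 0 → q z = 0) (W : Ω → α) (a : α) (h : pushMass p W a = 0) :
    pushMass q W a = 0 :=
  (pushMass_eq_zero_iff hq).2 fun z hz => hpq z ((pushMass_eq_zero_iff hp).1 h z hz)

theorem pushMass_mono {p p' : Ω → ℝ} (h : ∀ z, p z ≤ p' z) (W : Ω → α) (a : α) :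
    pushMass p W a ≤ pushMass p' W a := sum_le_sum fun z _ => h z

theorem pushMass_congr {p : Ω → ℝ} {W : Ω → α} {W' : Ω → β}
    {z : Ω} (h : ∀ z', W z' = W z ↔ W' z' = W' z) :
    pushMass p W (W z) = pushMass p W' (W' z) := by
  classical
  simp only [pushMass, h]

theorem sum_pushMass_prod [Fintype β] (p : Ω → ℝ) (U : Ω → α) (X : Ω → β) (u : α) :
    ∑ x, pushMass p (fun z => (U z, X z)) (u, x) = pushMass p U u := by
  classical
  simp only [pushMass]
  rw [← sum_fiberwise (univ.filter fun z => U z = u) X]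
  refine sum_congr rfl fun x _ => sum_congr ?_ fun _ _ => rfl
  ext z
  simp

/-- The density on the σ-algebra generated by `W` of the weights `q` relative to `p`. -/
noncomputable def pushDensity (p q : Ω → ℝ) (W : Ω → α) (z : Ω) : ℝ :=
  pushMass q W (W z) / pushMass p W (W z)

theorem pushDensity_nonneg {p q : Ω → ℝ} (hp : ∀ z, 0 ≤ p z) (hq : ∀ z, 0 ≤ q z) (W : Ω → α)
    (z : Ω) : 0 ≤ pushDensity p q W z :=
  div_nonneg (pushMass_nonneg hq _ _) (pushMass_nonneg hp _ _)

theorem pushDensity_congr {p q : Ω → ℝ} {W : Ω → α} {W' : Ω → β}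
    (h : ∀ z z', W z' = W z ↔ W' z' = W' z) : pushDensity p q W = pushDensity p q W' := by
  ext z
  rw [pushDensity, pushDensity, pushMass_congr (h z), pushMass_congr (h z)]

/-- The relative entropy of `q` with respect to `p` on the σ-algebra generated by `W`. -/
noncomputable def pushEntropy (p q : Ω → ℝ) (W : Ω → α) : ℝ :=
  ∑ z, q z * Real.log (pushDensity p q W z)

/-- The law of `Y` when the law of `W` is that under `q`, and the conditional law given `W` is that
under `p`. -/
noncomputable def mixedMass (p q : Ω → ℝ) (W : Ω → α) (Y : Ω → κ) (y : κ) : ℝ :=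
  ∑ z, restrictEq p Y y z * pushDensity p q W z

theorem mixedMass_nonneg {p q : Ω → ℝ} (hp : ∀ z, 0 ≤ p z) (hq : ∀ z, 0 ≤ q z) (W : Ω → α)
    (Y : Ω → κ) (y : κ) : 0 ≤ mixedMass p q W Y y :=
  sum_nonneg fun _ _ => mul_nonneg (restrictEq_nonneg hp _ _ _) (pushDensity_nonneg hp hq _ _)

theorem sum_restrictEq (p : Ω → ℝ) (Y : Ω → κ) (y : κ) :
    ∑ z, restrictEq p Y y z = pushMass p Y y := by
  classical
  rw [pushMass, sum_filter]
  exact sum_congr rfl fun z _ => by simp [restrictEq]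

theorem sum_pushMass_restrictEq [Fintype κ] (p : Ω → ℝ) (W : Ω → α) (Y : Ω → κ) (a : α) :
    ∑ y, pushMass (restrictEq p Y y) W a = pushMass p W a := by
  classical
  simp only [pushMass]
  rw [sum_comm]
  exact sum_congr rfl fun z _ => by simp [restrictEq]

/-- The start of the interpolation: nothing is disclosed, so the density is `1`. -/
theorem mixedMass_of_subsingleton {p q : Ω → ℝ} (hp : ∑ z, p z = 1) (hq : ∑ z, q z = 1)
    {W : Ω → α} (hW : ∀ z z', W z' = W z) (Y : Ω → κ) (y : κ) :
    mixedMass p q W Y y = pushMass p Y y := by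
  classical
  have h : ∀ z, pushDensity p q W z = 1 := by
    intro z
    simp [pushDensity, pushMass, hW z, hp, hq]
  simp only [mixedMass, h, mul_one, sum_restrictEq]

/-- Once `W` determines `Y`, no randomness from `p` is left. This gives the end of the interpolation
and shows that it is constant after coordinate `j` has been disclosed. -/
theorem mixedMass_of_factor [Fintype α] {p q : Ω → ℝ} (hp : ∀ z, 0 ≤ p z)
    (hq : ∀ z, 0 ≤ q z) (hpq : ∀ z, p z = 0 → q z = 0) {W : Ω → α} {Y : Ω → κ}
    (hY : ∀ z z', W z = W z' → Y z = Y z') (y : κ) :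
    mixedMass p q W Y y = pushMass q Y y := by
  classical
  rw [← sum_restrictEq, mixedMass]
  have e1 := sum_pushMass_mul (restrictEq p Y y) W (fun a => pushMass q W a / pushMass p W a)
  have e2 := sum_pushMass_mul (restrictEq q Y y) W (fun _ => 1)
  simp only [mul_one] at e2
  rw [← e2]
  refine e1.symm.trans (sum_congr rfl fun a _ => ?_)
  have hfac : ∀ r : Ω → ℝ, (∃ z, W z = a ∧ Y z = y) →
      pushMass (restrictEq r Y y) W a = pushMass r W a := by
    rintro r ⟨z, rfl, rfl⟩
    refine sum_congr rfl fun z' hz' => ?_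
    rw [restrictEq, if_pos (hY _ _ (mem_filter.1 hz').2)]
  have hzero : ∀ r : Ω → ℝ, (¬∃ z, W z = a ∧ Y z = y) →
      pushMass (restrictEq r Y y) W a = 0 := by
    intro r h
    refine sum_eq_zero fun z' hz' => ?_
    rw [restrictEq, if_neg fun h' => h ⟨z', (mem_filter.1 hz').2, h'⟩]
  by_cases h : ∃ z, W z = a ∧ Y z = y
  · rw [hfac p h, hfac q h]
    by_cases h0 : pushMass p W a = 0
    · simp [h0, pushMass_eq_zero_of_ac hp hq hpq W a h0]
    · field_simp
  · rw [hzero p h, hzero q h, zero_mul]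

/-- One step of the chain: disclosing `X` in addition to `U`. -/
theorem sum_sqrtDefect_mixedMass_le [Fintype α] [Fintype β] [Fintype κ] {p q : Ω → ℝ}
    (hp : ∀ z, 0 ≤ p z) (hq : ∀ z, 0 ≤ q z) (hpq : ∀ z, p z = 0 → q z = 0)
    (U : Ω → α) (X : Ω → β) (Y : Ω → κ) {c : ℝ} (hc : 0 ≤ c)
    (hTV : ∀ u x x', pushMass p (fun z => (U z, X z)) (u, x) ≠ 0 →
      pushMass p (fun z => (U z, X z)) (u, x') ≠ 0 →
      ∑ y, max (pushMass (restrictEq p Y y) (fun z => (U z, X z)) (u, x)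
          / pushMass p (fun z => (U z, X z)) (u, x)
        - pushMass (restrictEq p Y y) (fun z => (U z, X z)) (u, x')
          / pushMass p (fun z => (U z, X z)) (u, x')) 0 ≤ c) :
    ∑ y, sqrtDefect (mixedMass p q U Y y) (mixedMass p q (fun z => (U z, X z)) Y y) ^ 2
      ≤ c * (2 * (pushEntropy p q (fun z => (U z, X z)) - pushEntropy p q U)) := by
  set W : Ω → α × β := fun z => (U z, X z) with hW
  -- `v` is the law of `(U, X)` under `q`; `w` keeps the `q`-law of `U` but draws `X` from its
  -- conditional law under `p`. `K` is the conditional law of `Y` under `p`.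
  set v : α → β → ℝ := fun u x => pushMass q W (u, x) with hv
  set w : α → β → ℝ := fun u x => pushMass q U u / pushMass p U u * pushMass p W (u, x) with hw
  set K : α → β → κ → ℝ := fun u x y => pushMass (restrictEq p Y y) W (u, x) / pushMass p W (u, x)
    with hK
  have hv0 : ∀ u x, 0 ≤ v u x := fun u x => pushMass_nonneg hq _ _
  have hw0 : ∀ u x, 0 ≤ w u x := fun u x => mul_nonneg
    (div_nonneg (pushMass_nonneg hq _ _) (pushMass_nonneg hp _ _)) (pushMass_nonneg hp _ _)
  have hacU := pushMass_eq_zero_of_ac hp hq hpq U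
  have hacW := pushMass_eq_zero_of_ac hp hq hpq W
  have hwv : ∀ u, ∑ x, w u x = ∑ x, v u x := by
    intro u
    simp only [hw, hv, hW]
    rw [← mul_sum, sum_pushMass_prod, sum_pushMass_prod]
    by_cases h : pushMass p U u = 0
    · simp [h, hacU u h]
    · field_simp
  have hr : ∀ y a, pushMass p W a = 0 → pushMass (restrictEq p Y y) W a = 0 := fun y a h =>
    le_antisymm ((pushMass_mono (restrictEq_le hp Y y) W a).trans_eq h)
      (pushMass_nonneg (restrictEq_nonneg hp Y y) _ _)
  have hm0 : ∀ y, mixedMass p q U Y y = ∑ u, ∑ x, w u x * K u x y := by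
    intro y
    have e := sum_pushMass_mul (restrictEq p Y y) W (fun a => pushMass q U a.1 / pushMass p U a.1)
    rw [mixedMass]
    refine e.symm.trans ?_
    rw [Fintype.sum_prod_type]
    refine sum_congr rfl fun u _ => sum_congr rfl fun x _ => ?_
    simp only [hw, hK]
    by_cases h : pushMass p W (u, x) = 0
    · simp [h, hr y _ h]
    · field_simp
  have hm1 : ∀ y, mixedMass p q W Y y = ∑ u, ∑ x, v u x * K u x y := by
    intro y
    have e := sum_pushMass_mul (restrictEq p Y y) W (fun a => pushMass q W a / pushMass p W a)
    rw [mixedMass]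
    refine e.symm.trans ?_
    rw [Fintype.sum_prod_type]
    refine sum_congr rfl fun u _ => sum_congr rfl fun x _ => ?_
    simp only [hv, hK]
    ring
  have hvp : ∀ u x, v u x ≠ 0 → pushMass p W (u, x) ≠ 0 := fun u x h h0 => h (hacW _ h0)
  have hwp : ∀ u x, w u x ≠ 0 → pushMass p W (u, x) ≠ 0 := fun u x h h0 => h (by simp [hw, h0])
  have hwne : ∀ u x, v u x ≠ 0 → w u x ≠ 0 := by
    intro u x h
    have h1 : pushMass q U u ≠ 0 := by
      intro h0
      have h2 := (pushMass_eq_zero_iff hq).1 h0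
      exact h ((pushMass_eq_zero_iff hq).2 fun z hz => h2 z (congrArg Prod.fst hz))
    have h2 : pushMass p U u ≠ 0 := fun h0 => h1 (hacU _ h0)
    exact mul_ne_zero (div_ne_zero h1 h2) (hvp u x h)
  simp only [hm0, hm1]
  refine (sum_sqrtDefect_sq_le w v K hc hw0 hv0 (fun u x y =>
    div_nonneg (pushMass_nonneg (restrictEq_nonneg hp Y y) _ _) (pushMass_nonneg hp _ _)) hwv
    (fun u x x' h h' => hTV u x x' (hwp _ _ h) (hvp _ _ h'))).trans ?_
  refine mul_le_mul_of_nonneg_left ?_ hc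
  -- Chain rule: the entropy gained by disclosing `X` is the relative entropy of `v` with respect to
  -- `w`.
  have hent : pushEntropy p q W - pushEntropy p q U
      = ∑ u, ∑ x, v u x * Real.log (v u x / w u x) := by
    have e := sum_pushMass_mul q W (fun a => Real.log (v a.1 a.2 / w a.1 a.2))
    rw [← Fintype.sum_prod_type']
    refine Eq.trans ?_ e.symm
    rw [pushEntropy, pushEntropy, ← sum_sub_distrib]
    refine sum_congr rfl fun z _ => ?_
    by_cases hz : q z = 0
    · simp [hz]
    have hvz : v (U z) (X z) ≠ 0 := fun h0 => hz ((pushMass_eq_zero_iff hq).1 h0 z rfl)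
    have hpz := hvp _ _ hvz
    have hwz := hwne _ _ hvz
    have hUU : pushMass q U (U z) / pushMass p U (U z) ≠ 0 := left_ne_zero_of_mul hwz
    rw [← mul_sub, pushDensity, pushDensity]
    congr 1
    rw [← Real.log_div (div_ne_zero hvz hpz) hUU]
    congr 1
    simp only [hw, hv]
    change pushMass q W (U z, X z) / pushMass p W (U z, X z) / _ = _
    rw [div_div, mul_comm]
  rw [hent]
  have hb : ∀ u x, max (w u x - v u x) 0 ^ 2 / w u x
      ≤ 2 * (v u x * Real.log (v u x / w u x) - v u x + w u x) := by
    intro u x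
    rcases (hw0 u x).eq_or_lt with h | h
    · have : v u x = 0 := by
        by_contra h'
        exact hwne u x h' h.symm
      simp [← h, this]
    · exact sq_max_sub_div_le (hv0 u x) h
  calc ∑ u, ∑ x, max (w u x - v u x) 0 ^ 2 / w u x
      ≤ ∑ u, ∑ x, 2 * (v u x * Real.log (v u x / w u x) - v u x + w u x) :=
        sum_le_sum fun u _ => sum_le_sum fun x _ => hb u x
    _ = 2 * ∑ u, ∑ x, v u x * Real.log (v u x / w u x) := by
        rw [mul_sum]
        refine sum_congr rfl fun u _ => ?_
        -- The linear terms `-v + w` cancel because the marginals on `u` agree.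
        rw [← mul_sum, sum_add_distrib, sum_sub_distrib, hwv u]
        ring

end Finite

theorem sum_mul_mulVec_le_matOpNorm {T : ℕ} (M : Matrix (Fin T) (Fin T) ℝ) (a b : Fin T → ℝ) :
    ∑ k, a k * M.mulVec b k ≤ matOpNorm M * √(∑ k, a k ^ 2) * √(∑ k, b k ^ 2) := by
  have h1 := real_inner_le_norm (WithLp.toLp 2 a) (Matrix.toEuclideanCLM (𝕜 := ℝ) M (WithLp.toLp 2 b))
  have h2 := (Matrix.toEuclideanCLM (𝕜 := ℝ) M).le_opNorm (WithLp.toLp 2 b)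
  have h3 : ∑ k, a k * M.mulVec b k
      = inner ℝ (WithLp.toLp 2 a) (Matrix.toEuclideanCLM (𝕜 := ℝ) M (WithLp.toLp 2 b)) := by
    simp [PiLp.inner_apply, mul_comm]
  have ha : ‖WithLp.toLp 2 a‖ = √(∑ k, a k ^ 2) := by simp [EuclideanSpace.norm_eq]
  have hb : ‖WithLp.toLp 2 b‖ = √(∑ k, b k ^ 2) := by simp [EuclideanSpace.norm_eq]
  rw [h3]
  refine h1.trans ?_
  rw [ha]
  rw [hb] at h2
  calc _ ≤ √(∑ k, a k ^ 2) * (matOpNorm M * √(∑ k, b k ^ 2)) :=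
        mul_le_mul_of_nonneg_left h2 (Real.sqrt_nonneg _)
    _ = _ := by ring

/-! ### The transport inequality on path space. -/

section Path

variable {ι : Type*} {T : ℕ}

/-- The first `k` coordinates of a path. -/
def pathPrefix (k : ℕ) (z : Fin T → ι) : {t : Fin T // (t : ℕ) < k} → ι := fun t => z t.1

/-- The coordinates of a path up to and including `k`, the last one apart. -/
def pathUpTo (k : Fin T) (z : Fin T → ι) : ({t : Fin T // (t : ℕ) < k} → ι) × ι :=
  (pathPrefix k z, z k)

theorem pathPrefix_succ_eq_iff (k : Fin T) (z z' : Fin T → ι) :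
    pathPrefix ((k : ℕ) + 1) z' = pathPrefix ((k : ℕ) + 1) z ↔ pathUpTo k z' = pathUpTo k z := by
  simp only [pathPrefix, pathUpTo, Prod.mk.injEq, funext_iff, Subtype.forall]
  constructor
  · intro h
    exact ⟨fun t ht => h t (by omega), h k (by omega)⟩
  · rintro ⟨h1, h2⟩ t ht
    rcases (Nat.lt_succ_iff_lt_or_eq.1 ht) with h | h
    · exact h1 t h
    · rw [Fin.ext h]
      exact h2

variable [Fintype ι]

/-- Samson's transport inequality for additive functionals on a finite alphabet. -/
theorem sum_sub_sum_le_matOpNorm_mul_sqrt_entropy {p q : (Fin T → ι) → ℝ}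
    (hp : ∀ z, 0 ≤ p z) (hq : ∀ z, 0 ≤ q z) (hp1 : ∑ z, p z = 1) (hq1 : ∑ z, q z = 1)
    (hpq : ∀ z, p z = 0 → q z = 0) {h : ι → ℝ} (hh : ∀ y, 0 ≤ h y)
    (M : Matrix (Fin T) (Fin T) ℝ) (hMdiag : ∀ i, M i i = 1) (hMlow : ∀ i j, j < i → M i j = 0)
    (hMnonneg : ∀ i j, 0 ≤ M i j)
    (hmix : ∀ i j, i < j → ∀ a, pushMass p (pathUpTo i) a ≠ 0 → ∀ S : Finset ι,
      |(∑ y ∈ S, pushMass (restrictEq p (fun z => z j) y) (pathUpTo i) a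
          / pushMass p (pathUpTo i) a)
        - ∑ y ∈ S, pushMass p (fun z => z j) y| ≤ M i j ^ 2 / 2) :
    ∑ z, p z * (∑ t, h (z t)) - ∑ z, q z * (∑ t, h (z t))
      ≤ matOpNorm M * √(2 * ∑ z, q z * Real.log (q z / p z))
        * √(∑ z, p z * ∑ t, h (z t) ^ 2) := by
  classical
  set H : ℕ → ℝ := fun k => pushEntropy p q (pathPrefix (T := T) (ι := ι) k) with hH
  have hdens : ∀ k : Fin T, pushDensity p q (pathPrefix (ι := ι) ((k : ℕ) + 1))
      = pushDensity p q (pathUpTo k) := fun k => pushDensity_congr (pathPrefix_succ_eq_iff k)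
  have hHs : ∀ k : Fin T, H (k + 1) = pushEntropy p q (pathUpTo k) := by
    intro k
    simp only [hH, pushEntropy, hdens]
  have hH0 : H 0 = 0 := by
    have : ∀ z, pushDensity p q (pathPrefix (T := T) (ι := ι) 0) z = 1 := by
      intro z
      have : ∀ z z' : Fin T → ι, pathPrefix 0 z' = pathPrefix 0 z := by
        intro z z'
        ext t
        exact absurd t.2 (by omega)
      simp [pushDensity, pushMass, this z, hp1, hq1]
    simp [hH, pushEntropy, this]
  have hHT : H T = ∑ z, q z * Real.log (q z / p z) := by
    have inj : ∀ z z' : Fin T → ι, pathPrefix T z' = pathPrefix T z ↔ z' = z := by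
      intro z z'
      refine ⟨fun e => ?_, fun e => by rw [e]⟩
      ext t
      exact congrFun e ⟨t, t.2⟩
    refine sum_congr rfl fun z _ => ?_
    simp [pushDensity, pushMass, inj, sum_filter]
  have hMsq : ∀ k j : Fin T, ∑ y, sqrtDefect (mixedMass p q (pathPrefix (k : ℕ)) (fun z => z j) y)
      (mixedMass p q (pathPrefix ((k : ℕ) + 1)) (fun z => z j) y) ^ 2
      ≤ M k j ^ 2 * (2 * (H (k + 1) - H k)) := by
    intro k j
    have hNs : ∀ y, mixedMass p q (pathPrefix ((k : ℕ) + 1)) (fun z => z j) y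
        = mixedMass p q (pathUpTo (ι := ι) k) (fun z => z j) y := by
      intro y
      simp only [mixedMass, hdens]
    rcases lt_trichotomy j k with hjk | hjk | hjk
    -- Coordinate `j` is already disclosed, so the step changes nothing.
    · have hf : ∀ (n : ℕ) y, (j : ℕ) < n →
          mixedMass p q (pathPrefix n) (fun z => z j) y = pushMass q (fun z => z j) y :=
        fun n y hn => mixedMass_of_factor hp hq hpq (fun z z' e => congrFun e ⟨j, hn⟩) y
      have hjk' : (j : ℕ) < k := hjk
      simp [hf k _ hjk', hf (k + 1) _ (by omega), sqrtDefect_self, hMlow k j hjk]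
    · subst hjk
      simp only [hNs]
      rw [hHs]
      refine sum_sqrtDefect_mixedMass_le hp hq hpq (pathPrefix (j : ℕ)) (fun z => z j)
        (fun z => z j) (sq_nonneg _) fun u x x' hx hx' => ?_
      -- Disclosing `j` itself: the trivial bound by total mass `1` matches the diagonal entry.
      rw [hMdiag, one_pow]
      calc _ ≤ ∑ y, pushMass (restrictEq p (fun z => z j) y) (pathUpTo j) (u, x)
            / pushMass p (pathUpTo j) (u, x) := by
            have hK : ∀ y x, 0 ≤ pushMass (restrictEq p (fun z => z j) y) (pathUpTo j) (u, x)
                / pushMass p (pathUpTo j) (u, x) := fun y x =>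
              div_nonneg (pushMass_nonneg (restrictEq_nonneg hp _ y) _ _) (pushMass_nonneg hp _ _)
            exact sum_le_sum fun y _ => max_le (sub_le_self _ (hK y x')) (hK y x)
        _ = 1 := by
            rw [← sum_div, sum_pushMass_restrictEq]
            exact div_self hx
    · simp only [hNs]
      rw [hHs]
      refine sum_sqrtDefect_mixedMass_le hp hq hpq (pathPrefix (k : ℕ)) (fun z => z k)
        (fun z => z j) (sq_nonneg _) fun u x x' hx hx' => ?_
      have h1 := hmix k j hjk (u, x) hx
      have h2 := hmix k j hjk (u, x') hx'
      -- On the set where the first row exceeds the second, the positive parts add up to a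
      -- difference of two conditional probabilities. Each is within `M² / 2` of the unconditional
      -- one, which gives `M²`.
      set S : Finset ι := univ.filter fun y =>
        pushMass (restrictEq p (fun z => z j) y) (pathUpTo k) (u, x')
            / pushMass p (pathUpTo k) (u, x')
          < pushMass (restrictEq p (fun z => z j) y) (pathUpTo k) (u, x)
            / pushMass p (pathUpTo k) (u, x)
      have e : ∀ a b : ℝ, max (a - b) 0 = if b < a then a - b else 0 := by
        intro a b
        split_ifs with hab
        · exact max_eq_left (by linarith)
        · exact max_eq_right (by linarith)
      simp only [e]
      rw [← sum_filter, sum_sub_distrib]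
      have h1' := (abs_le.1 (h1 S)).2
      have h2' := (abs_le.1 (h2 S)).1
      change ∑ y ∈ S, pushMass (restrictEq p (fun z => z j) y) (pathUpTo k) (u, x)
            / pushMass p (pathUpTo k) (u, x)
          - ∑ y ∈ S, pushMass (restrictEq p (fun z => z j) y) (pathUpTo k) (u, x')
            / pushMass p (pathUpTo k) (u, x') ≤ _
      linarith
  have hHmono : ∀ k : Fin T, 0 ≤ 2 * (H (k + 1) - H k) := by
    intro k
    -- Since `M k k = 1`, the diagonal case bounds a sum of squares by the doubled entropy
    -- increment.
    have := hMsq k k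
    rw [hMdiag, one_pow, one_mul] at this
    exact (sum_nonneg fun _ _ => sq_nonneg _).trans this
  set a : Fin T → ℝ := fun k => √(2 * (H (k + 1) - H k)) with ha
  set b : Fin T → ℝ := fun j => √(∑ y, h y ^ 2 * pushMass p (fun z => z j) y) with hb
  have hb2 : ∑ j, b j ^ 2 = ∑ z, p z * ∑ t, h (z t) ^ 2 := by
    simp only [mul_sum]
    rw [sum_comm]
    refine sum_congr rfl fun j _ => ?_
    rw [← sum_pushMass_mul p (fun z => z j) (fun y => h y ^ 2), hb, Real.sq_sqrt]
    · exact sum_congr rfl fun y _ => mul_comm _ _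
    · exact sum_nonneg fun y _ => mul_nonneg (sq_nonneg _) (pushMass_nonneg hp _ _)
  have ha2 : ∑ k, a k ^ 2 = 2 * ∑ z, q z * Real.log (q z / p z) := by
    rw [← hHT]
    simp only [ha, Real.sq_sqrt (hHmono _)]
    rw [← mul_sum, Fin.sum_univ_eq_sum_range (fun k => H (k + 1) - H k) T, sum_range_sub, hH0,
      sub_zero]
  have hcoord : ∀ j, ∑ z, p z * h (z j) - ∑ z, q z * h (z j) ≤ ∑ k, a k * (M k j * b j) := by
    intro j
    set N : ℕ → ι → ℝ := fun k => mixedMass p q (pathPrefix k) (fun z => z j)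
    have hN : ∀ k y, 0 ≤ N k y := fun k y => mixedMass_nonneg hp hq _ _ _
    have hN0 : ∀ y, N 0 y = pushMass p (fun z => z j) y := by
      refine fun y => mixedMass_of_subsingleton hp1 hq1 (fun z z' => ?_) _ y
      ext t
      exact absurd t.2 (by omega)
    have hNT : ∀ y, N T y = pushMass q (fun z => z j) y := fun y =>
      mixedMass_of_factor hp hq hpq (fun z z' e => congrFun e ⟨j, j.2⟩) y
    rw [← sum_pushMass_mul p (fun z => z j) h, ← sum_pushMass_mul q (fun z => z j) h]
    simp only [← hN0, ← hNT]
    rw [← sum_sub_distrib]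
    calc ∑ y, (N 0 y * h y - N T y * h y)
        ≤ ∑ y, ∑ k : Fin T, (h y * √(N 0 y)) * sqrtDefect (N k y) (N (k + 1) y) := by
          refine sum_le_sum fun y _ => ?_
          rw [← mul_sum,
            Fin.sum_univ_eq_sum_range (fun k => sqrtDefect (N k y) (N (k + 1) y)) T]
          have h1 := sub_le_sqrt_mul_sqrtDefect (hN 0 y) (hN T y)
          have h2 := sqrtDefect_le_sum (fun k => N k y) (fun k => hN k y) T
          calc N 0 y * h y - N T y * h y = h y * (N 0 y - N T y) := by ring
            _ ≤ h y * (√(N 0 y) * ∑ k ∈ range T, sqrtDefect (N k y) (N (k + 1) y)) :=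
              mul_le_mul_of_nonneg_left
                (h1.trans (mul_le_mul_of_nonneg_left h2 (Real.sqrt_nonneg _))) (hh y)
            _ = _ := by ring
      _ = ∑ k : Fin T, ∑ y, (h y * √(N 0 y)) * sqrtDefect (N k y) (N (k + 1) y) := sum_comm
      _ ≤ ∑ k, a k * (M k j * b j) := by
          refine sum_le_sum fun k _ => ?_
          refine (Real.sum_mul_le_sqrt_mul_sqrt _ _ _).trans ?_
          have h1 : ∑ y, (h y * √(N 0 y)) ^ 2 = ∑ y, h y ^ 2 * pushMass p (fun z => z j) y :=
            sum_congr rfl fun y _ => by rw [mul_pow, Real.sq_sqrt (hN 0 y), hN0]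
          rw [h1]
          have h2 : √(∑ y, sqrtDefect (N k y) (N (k + 1) y) ^ 2) ≤ M k j * a k := by
            refine (Real.sqrt_le_sqrt (hMsq k j)).trans_eq ?_
            rw [Real.sqrt_mul (sq_nonneg _), Real.sqrt_sq (hMnonneg k j)]
          calc b j * _ ≤ b j * (M k j * a k) :=
                mul_le_mul_of_nonneg_left h2 (Real.sqrt_nonneg _)
            _ = _ := by ring
  have hfin := sum_mul_mulVec_le_matOpNorm M a b
  rw [ha2, hb2] at hfin
  refine le_trans ?_ hfin
  simp only [mul_sum, Matrix.mulVec, dotProduct]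
  rw [sum_comm, sum_comm (s := (univ : Finset (Fin T → ι))) (t := (univ : Finset (Fin T))),
    ← sum_sub_distrib, sum_comm (γ := Fin T) (s := univ) (t := univ)]
  exact sum_le_sum fun j _ => hcoord j

end Path

/-! ### From the law of the process to finite weights. -/

section Law

open MeasureTheory ProbabilityTheory

theorem abs_measureReal_sub_le_one {E : Type*} [MeasurableSpace E] (μ ν : Measure E)
    [IsProbabilityMeasure μ] [IsProbabilityMeasure ν] (A : Set E) :
    |μ.real A - ν.real A| ≤ 1 := by
  have h1 : μ.real A ≤ 1 := measureReal_le_one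
  have h2 : ν.real A ≤ 1 := measureReal_le_one
  have h3 : 0 ≤ μ.real A := measureReal_nonneg
  have h4 : 0 ≤ ν.real A := measureReal_nonneg
  rw [abs_le]
  constructor <;> linarith

theorem abs_measureReal_sub_le_tvDist {E : Type*} [MeasurableSpace E] (μ ν : Measure E)
    [IsProbabilityMeasure μ] [IsProbabilityMeasure ν] {A : Set E} (hA : MeasurableSet A) :
    |μ.real A - ν.real A| ≤ tvDist μ ν :=
  le_ciSup (f := fun A : {A : Set E // MeasurableSet A} => |μ.real A.1 - ν.real A.1|)
    ⟨1, by rintro _ ⟨A, rfl⟩; exact abs_measureReal_sub_le_one μ ν A⟩ ⟨A, hA⟩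

theorem tvDist_le_one {E : Type*} [MeasurableSpace E] (μ ν : Measure E)
    [IsProbabilityMeasure μ] [IsProbabilityMeasure ν] : tvDist μ ν ≤ 1 :=
  Real.iSup_le (fun A => abs_measureReal_sub_le_one μ ν A) zero_le_one

theorem tvDist_nonneg {E : Type*} [MeasurableSpace E] (μ ν : Measure E) : 0 ≤ tvDist μ ν :=
  Real.iSup_nonneg fun _ => abs_nonneg _

variable {T : ℕ} {E : Type*} [MeasurableSpace E]

theorem measurable_tail (j : Fin T) :
    Measurable fun (z : Fin T → E) (k : Set.Ici j) => z k.1 :=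
  measurable_pi_lambda _ fun k => measurable_pi_apply k.1

instance isProbabilityMeasure_tailLaw (μ : Measure (Fin T → E)) [IsProbabilityMeasure μ]
    (j : Fin T) : IsProbabilityMeasure (tailLaw μ j) :=
  Measure.isProbabilityMeasure_map (measurable_tail j).aemeasurable

theorem depCoeff_nonneg (μ : Measure (Fin T → E)) (i j : Fin T) : 0 ≤ depCoeff μ i j :=
  Real.iSup_nonneg fun _ => tvDist_nonneg _ _

/-- Events about coordinate `j` are events of the tail. The bound `1` on total variation makes the
real supremum genuine, as an unbounded one would default to `0`. -/
theorem abs_cond_sub_le_depCoeff (μ : Measure (Fin T → E)) [IsProbabilityMeasure μ] (i j : Fin T)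
    {A : Set (Fin T → E)} (hA : @MeasurableSet _ (cylinderEvents (Set.Iic i)) A) (hA0 : μ A ≠ 0)
    {B : Set E} (hB : MeasurableSet B) :
    |(μ[|A]).real {x | x j ∈ B} - μ.real {x | x j ∈ B}| ≤ depCoeff μ i j := by
  have hP : IsProbabilityMeasure (μ[|A]) := cond_isProbabilityMeasure hA0
  have hB' : MeasurableSet {y : Set.Ici j → E | y ⟨j, Set.self_mem_Ici⟩ ∈ B} :=
    measurable_pi_apply _ hB
  have h1 := abs_measureReal_sub_le_tvDist (tailLaw (μ[|A]) j) (tailLaw μ j) hB'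
  rw [tailLaw, tailLaw, map_measureReal_apply (measurable_tail j) hB',
    map_measureReal_apply (measurable_tail j) hB'] at h1
  refine h1.trans ?_
  refine le_ciSup (f := fun A : {A : Set (Fin T → E) //
      @MeasurableSet _ (cylinderEvents (Set.Iic i)) A ∧ μ A ≠ 0} =>
    tvDist (tailLaw (μ[|A.1]) j) (tailLaw μ j)) ⟨1, ?_⟩ ⟨A, hA, hA0⟩
  rintro _ ⟨A, rfl⟩
  have : IsProbabilityMeasure (μ[|A.1]) := cond_isProbabilityMeasure A.2.2
  exact tvDist_le_one _ _

variable {ι : Type*} [MeasurableSpace ι]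

theorem measurable_code {ψ : E → ι} (hψ : Measurable ψ) :
    Measurable fun (x : Fin T → E) t => ψ (x t) :=
  measurable_pi_lambda _ fun t => hψ.comp (measurable_pi_apply t)

variable [MeasurableSingletonClass ι]

/-- Makes conditioning on the coded past admissible in the supremum that defines `depCoeff`. -/
theorem measurableSet_cylinderEvents_pathUpTo {ψ : E → ι} (hψ : Measurable ψ) (i : Fin T)
    (a : ({t : Fin T // (t : ℕ) < i} → ι) × ι) :
    @MeasurableSet _ (cylinderEvents (Set.Iic i))
      {x : Fin T → E | pathUpTo i (fun t => ψ (x t)) = a} := by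
  have : {x : Fin T → E | pathUpTo i (fun t => ψ (x t)) = a}
      = (⋂ t : {t : Fin T // (t : ℕ) < i}, (fun x => x t.1) ⁻¹' (ψ ⁻¹' {a.1 t}))
        ∩ (fun x => x i) ⁻¹' (ψ ⁻¹' {a.2}) := by
    ext x
    simp [pathUpTo, pathPrefix, Prod.ext_iff, funext_iff]
  rw [this]
  refine MeasurableSet.inter (MeasurableSet.iInter fun t => ?_) ?_
  · exact measurable_cylinderEvent_apply (X := fun _ => E) (i := t.1)
      (Δ := Set.Iic i) (Fin.le_def.2 t.2.le) (hψ (measurableSet_singleton _))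
  · exact measurable_cylinderEvent_apply (X := fun _ => E) (i := i)
      (Δ := Set.Iic i) (Set.self_mem_Iic) (hψ (measurableSet_singleton _))

/-- The weights of the law of the coded path `ψ ∘ x`. -/
noncomputable def codeMass (μ : Measure (Fin T → E)) (ψ : E → ι) (z : Fin T → ι) : ℝ :=
  μ.real ((fun x t => ψ (x t)) ⁻¹' {z})

theorem sum_codeMass (μ : Measure (Fin T → E)) [IsProbabilityMeasure μ] {ψ : E → ι}
    (hψ : Measurable ψ) (s : Finset (Fin T → ι)) :
    ∑ z ∈ s, codeMass μ ψ z = μ.real {x | (fun t => ψ (x t)) ∈ s} :=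
  sum_measureReal_preimage_singleton s fun z _ => measurable_code hψ (measurableSet_singleton z)

variable [Fintype ι]

theorem sum_codeMass_mul (μ : Measure (Fin T → E)) [IsProbabilityMeasure μ] {ψ : E → ι}
    (hψ : Measurable ψ) (F : (Fin T → ι) → ℝ) :
    ∑ z, codeMass μ ψ z * F z = ∫ x, F (fun t => ψ (x t)) ∂μ := by
  have hm := measurable_code (T := T) hψ
  have : IsProbabilityMeasure (μ.map fun x t => ψ (x t)) :=
    Measure.isProbabilityMeasure_map hm.aemeasurable
  rw [← integral_map hm.aemeasurable (f := F)
    (measurable_of_countable F).aestronglyMeasurable, integral_fintype Integrable.of_finite]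
  refine sum_congr rfl fun z _ => ?_
  rw [map_measureReal_apply hm (measurableSet_singleton z), smul_eq_mul, codeMass]

theorem pushMass_codeMass {α : Type*} (μ : Measure (Fin T → E)) [IsProbabilityMeasure μ]
    {ψ : E → ι} (hψ : Measurable ψ) (W : (Fin T → ι) → α) (a : α) :
    pushMass (codeMass μ ψ) W a = μ.real {x | W (fun t => ψ (x t)) = a} := by
  rw [pushMass, sum_codeMass μ hψ]
  simp

theorem sum_pushMass_restrictEq_codeMass {α : Type*} (μ : Measure (Fin T → E))
    [IsProbabilityMeasure μ] {ψ : E → ι} (hψ : Measurable ψ) (W : (Fin T → ι) → α) (a : α)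
    (j : Fin T) (S : Finset ι) :
    ∑ y ∈ S, pushMass (restrictEq (codeMass μ ψ) (fun z => z j) y) W a
      = μ.real ({x | W (fun t => ψ (x t)) = a} ∩ {x | x j ∈ ψ ⁻¹' S}) := by
  classical
  have : ∑ y ∈ S, pushMass (restrictEq (codeMass μ ψ) (fun z => z j) y) W a
      = ∑ z with W z = a ∧ z j ∈ S, codeMass μ ψ z := by
    simp only [pushMass, restrictEq]
    rw [sum_comm, ← filter_filter, sum_filter (fun z : Fin T → ι => z j ∈ S)]
    exact sum_congr rfl fun z _ => by simp
  rw [this, sum_codeMass μ hψ]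
  congr 1
  ext x
  simp

theorem depMatrix_self (μ : Measure (Fin T → E)) (i : Fin T) : depMatrix μ i i = 1 := by
  simp [depMatrix]

theorem depMatrix_of_lt (μ : Measure (Fin T → E)) {i j : Fin T} (h : j < i) :
    depMatrix μ i j = 0 := by
  simp [depMatrix, h.not_gt, h.ne']

theorem depMatrix_nonneg (μ : Measure (Fin T → E)) (i j : Fin T) : 0 ≤ depMatrix μ i j := by
  simp only [depMatrix, Matrix.of_apply]
  split_ifs
  exacts [Real.sqrt_nonneg _, zero_le_one, le_rfl]

theorem depMatrix_sq_div_two (μ : Measure (Fin T → E)) {i j : Fin T} (h : i < j) :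
    depMatrix μ i j ^ 2 / 2 = depCoeff μ i j := by
  rw [depMatrix, Matrix.of_apply, if_pos h, Real.sq_sqrt
    (mul_nonneg zero_le_two (depCoeff_nonneg _ _ _))]
  ring

/-- Lower-tail bound for a nonnegative additive functional with finitely many values. -/
theorem sum_integral_sub_le_of_finite (μ : Measure (Fin T → E)) [IsProbabilityMeasure μ]
    {ψ : E → ι} (hψ : Measurable ψ) {h : ι → ℝ} (hh : ∀ y, 0 ≤ h y) (s : ℝ)
    (hA : 0 < μ.real {x | ∑ t, h (ψ (x t)) ≤ s}) :
    ∫ x, ∑ t, h (ψ (x t)) ∂μ - s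
      ≤ matOpNorm (depMatrix μ) * √(2 * -Real.log (μ.real {x | ∑ t, h (ψ (x t)) ≤ s}))
        * √(∫ x, ∑ t, h (ψ (x t)) ^ 2 ∂μ) := by
  classical
  set p := codeMass μ ψ with hp_def
  set A : Finset (Fin T → ι) := univ.filter fun z => ∑ t, h (z t) ≤ s with hA_def
  have hpA : ∑ z ∈ A, p z = μ.real {x | ∑ t, h (ψ (x t)) ≤ s} := by
    rw [hp_def, sum_codeMass μ hψ]
    simp [hA_def]
  set m := μ.real {x | ∑ t, h (ψ (x t)) ≤ s}
  -- `q` is `p` conditioned on `A`; its density is `1 / m` there, so its entropy is `-log m`.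
  set q : (Fin T → ι) → ℝ := fun z => if z ∈ A then p z / m else 0 with hq_def
  have hp : ∀ z, 0 ≤ p z := fun z => measureReal_nonneg
  have hq : ∀ z, 0 ≤ q z := by
    intro z
    simp only [hq_def]
    split_ifs
    exacts [div_nonneg (hp z) hA.le, le_rfl]
  have hp1 : ∑ z, p z = 1 := by
    rw [hp_def, sum_codeMass μ hψ]
    simp
  have hqsum : ∀ F : (Fin T → ι) → ℝ, ∑ z, q z * F z = ∑ z ∈ A, p z / m * F z := by
    intro F
    simp only [hq_def, ite_mul, zero_mul]
    rw [← sum_filter]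
    simp
  have hA1 : ∑ z ∈ A, p z / m = 1 := by rw [← sum_div, hpA, div_self hA.ne']
  have hq1 : ∑ z, q z = 1 := by simpa [hA1] using hqsum fun _ => 1
  have hpq : ∀ z, p z = 0 → q z = 0 := by
    intro z hz
    simp [hq_def, hz]
  have key := sum_sub_sum_le_matOpNorm_mul_sqrt_entropy hp hq hp1 hq1 hpq hh (depMatrix μ)
    (depMatrix_self μ) (fun i j => depMatrix_of_lt μ) (depMatrix_nonneg μ) ?_
  · have hent : ∑ z, q z * Real.log (q z / p z) = -Real.log m := by
      rw [hqsum]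
      have : ∀ z ∈ A, p z / m * Real.log (q z / p z) = p z / m * -Real.log m := by
        intro z hz
        by_cases h0 : p z = 0
        · simp [h0]
        · rw [hq_def]
          simp only [if_pos hz]
          rw [div_div, mul_comm m, ← div_div, div_self h0, one_div, Real.log_inv]
      rw [sum_congr rfl this, ← sum_mul, hA1, one_mul]
    have hqs : ∑ z, q z * ∑ t, h (z t) ≤ s := by
      rw [hqsum]
      calc ∑ z ∈ A, p z / m * ∑ t, h (z t) ≤ ∑ z ∈ A, p z / m * s :=
            sum_le_sum fun z hz => mul_le_mul_of_nonneg_left (mem_filter.1 hz).2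
              (div_nonneg (hp z) hA.le)
        _ = s := by rw [← sum_mul, hA1, one_mul]
    rw [hent, hp_def, sum_codeMass_mul μ hψ, sum_codeMass_mul μ hψ] at key
    linarith
  · intro i j hij a ha S
    rw [depMatrix_sq_div_two μ hij, ← sum_div, sum_pushMass_restrictEq_codeMass μ hψ]
    have h1 : ∑ y ∈ S, pushMass p (fun z => z j) y = μ.real {x | x j ∈ ψ ⁻¹' S} := by
      -- Conditioning on a constant map recovers the unconditional marginal.
      have := sum_pushMass_restrictEq_codeMass μ hψ (fun _ => ()) () j S
      simp only [Set.ofPred_true, Set.univ_inter] at this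
      rw [← this]
      refine sum_congr rfl fun y _ => ?_
      simp only [pushMass, restrictEq]
      rw [sum_filter]
      simp [hp_def]
    rw [hp_def, pushMass_codeMass μ hψ] at ha ⊢
    rw [← hp_def, h1]
    have hm := measurableSet_cylinderEvents_pathUpTo hψ i a
    have hm' : MeasurableSet {x : Fin T → E | pathUpTo i (fun t => ψ (x t)) = a} :=
      cylinderEvents_le_pi _ hm
    have h2 := abs_cond_sub_le_depCoeff μ i j hm (fun h0 => ha (by simp [measureReal_def, h0]))
      (hψ S.measurableSet)
    rwa [measureReal_def (μ[|_]), cond_apply hm', ENNReal.toReal_mul, ENNReal.toReal_inv,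
      ← measureReal_def, ← measureReal_def, inv_mul_eq_div] at h2

end Law

/-! ### Discretisation of the observable. -/

section Main

open MeasureTheory Filter Topology

/-- The code of `r` on the grid of mesh `1 / (n + 1)`, cut off at height `n + 1`. -/
noncomputable def gridCode (n : ℕ) (r : ℝ) : Fin ((n + 1) ^ 2 + 1) :=
  ⟨min ⌊r * (n + 1 : ℕ)⌋₊ ((n + 1) ^ 2), Nat.lt_succ_of_le (min_le_right _ _)⟩

/-- The point of the grid with a given code. -/
noncomputable def gridValue (n : ℕ) (y : Fin ((n + 1) ^ 2 + 1)) : ℝ :=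
  ((y : ℕ) : ℝ) / ((n + 1 : ℕ) : ℝ)

theorem measurable_gridCode (n : ℕ) : Measurable (gridCode n) := by
  have h : Measurable fun r : ℝ => min ⌊r * (n + 1 : ℕ)⌋₊ ((n + 1) ^ 2) :=
    ((measurable_id.mul_const _).nat_floor).min measurable_const
  refine measurable_to_countable' fun y => ?_
  have : gridCode n ⁻¹' {y} = (fun r : ℝ => min ⌊r * (n + 1 : ℕ)⌋₊ ((n + 1) ^ 2)) ⁻¹' {(y : ℕ)} := by
    ext r
    simp [gridCode, Fin.ext_iff]
  rw [this]
  exact h (measurableSet_singleton _)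

theorem gridValue_nonneg (n : ℕ) (y : Fin ((n + 1) ^ 2 + 1)) : 0 ≤ gridValue n y := by
  unfold gridValue
  positivity

theorem gridValue_gridCode_le (n : ℕ) {r : ℝ} (hr : 0 ≤ r) : gridValue n (gridCode n r) ≤ r := by
  have hn : (0 : ℝ) < ((n + 1 : ℕ) : ℝ) := by positivity
  rw [gridValue, div_le_iff₀ hn]
  calc ((gridCode n r : ℕ) : ℝ) ≤ (⌊r * (n + 1 : ℕ)⌋₊ : ℝ) := Nat.cast_le.2 (min_le_left _ _)
    _ ≤ _ := Nat.floor_le (by positivity)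

theorem tendsto_gridValue_gridCode {r : ℝ} (hr : 0 ≤ r) :
    Tendsto (fun n => gridValue n (gridCode n r)) atTop (𝓝 r) := by
  have h1 : Tendsto (fun n : ℕ => ((n + 1 : ℕ) : ℝ)) atTop atTop :=
    tendsto_natCast_atTop_atTop.comp (tendsto_add_atTop_nat 1)
  refine ((tendsto_nat_floor_mul_div_atTop hr).comp h1).congr' ?_
  -- Once `n + 1 ≥ r` the cut-off is inactive.
  filter_upwards [h1.eventually_ge_atTop r] with n hn
  have h2 : ⌊r * (n + 1 : ℕ)⌋₊ ≤ (n + 1) ^ 2 := by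
    refine Nat.floor_le_of_le ?_
    calc r * (n + 1 : ℕ) ≤ (n + 1 : ℕ) * (n + 1 : ℕ) := by gcongr
      _ = _ := by push_cast; ring
  simp only [Function.comp_apply, gridValue, gridCode, min_eq_left h2]

/-- Lower-tail bound for a nonnegative square-integrable additive functional. -/
theorem sum_integral_sub_le_matOpNorm_mul {T : ℕ} {E : Type*} [MeasurableSpace E]
    (μ : Measure (Fin T → E)) [IsProbabilityMeasure μ] {g : E → ℝ} (hg : Measurable g)
    (hg0 : ∀ x, 0 ≤ g x) (hgi : ∀ t, Integrable (fun x : Fin T → E => g (x t) ^ 2) μ) (s : ℝ)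
    (hA : 0 < μ.real {x | ∑ t, g (x t) ≤ s}) :
    ∫ x, ∑ t, g (x t) ∂μ - s
      ≤ matOpNorm (depMatrix μ) * √(2 * -Real.log (μ.real {x | ∑ t, g (x t) ≤ s}))
        * √(∫ x, ∑ t, g (x t) ^ 2 ∂μ) := by
  have hgm : ∀ t, Measurable fun x : Fin T → E => g (x t) := fun t =>
    hg.comp (measurable_pi_apply t)
  have hg1 : ∀ t, Integrable (fun x : Fin T → E => g (x t)) μ := fun t =>
    ((memLp_two_iff_integrable_sq (hgm t).aestronglyMeasurable).2 (hgi t)).integrable one_le_two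
  set γ : ℕ → E → ℝ := fun n x => gridValue n (gridCode n (g x)) with hγ
  have hγ0 : ∀ n x, 0 ≤ γ n x := fun n x => gridValue_nonneg _ _
  have hγg : ∀ n x, γ n x ≤ g x := fun n x => gridValue_gridCode_le n (hg0 x)
  have hγm : ∀ n, Measurable (γ n) := fun n =>
    (measurable_of_countable (gridValue n)).comp ((measurable_gridCode n).comp hg)
  have hM : 0 ≤ matOpNorm (depMatrix μ) := norm_nonneg _
  have hbound : ∀ n, ∫ x, ∑ t, γ n (x t) ∂μ - s
      ≤ matOpNorm (depMatrix μ) * √(2 * -Real.log (μ.real {x | ∑ t, g (x t) ≤ s}))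
        * √(∫ x, ∑ t, g (x t) ^ 2 ∂μ) := by
    intro n
    -- Rounding down enlarges the event and lowers the second moment, so the right-hand side is
    -- already at most its limiting form for every `n`. Only the mean needs a limit.
    have hsub : μ.real {x | ∑ t, g (x t) ≤ s} ≤ μ.real {x | ∑ t, γ n (x t) ≤ s} :=
      measureReal_mono fun x hx => (sum_le_sum fun t _ => hγg n (x t)).trans hx
    have h1 := sum_integral_sub_le_of_finite μ ((measurable_gridCode n).comp hg)
      (gridValue_nonneg n) s (hA.trans_le hsub)
    refine h1.trans ?_
    have hlog := Real.log_le_log hA hsub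
    have hV : ∫ x, ∑ t, γ n (x t) ^ 2 ∂μ ≤ ∫ x, ∑ t, g (x t) ^ 2 ∂μ := by
      refine integral_mono_of_nonneg (ae_of_all _ fun x => sum_nonneg fun t _ => sq_nonneg _)
        (integrable_finsetSum _ fun t _ => hgi t) (ae_of_all _ fun x => sum_le_sum fun t _ => ?_)
      exact pow_le_pow_left₀ (hγ0 n _) (hγg n _) 2
    refine mul_le_mul (mul_le_mul_of_nonneg_left (Real.sqrt_le_sqrt ?_) hM)
      (Real.sqrt_le_sqrt hV) (Real.sqrt_nonneg _) (mul_nonneg hM (Real.sqrt_nonneg _))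
    exact mul_le_mul_of_nonneg_left (neg_le_neg hlog) zero_le_two
  have hlim : Tendsto (fun n => ∫ x, ∑ t, γ n (x t) ∂μ) atTop (𝓝 (∫ x, ∑ t, g (x t) ∂μ)) := by
    refine tendsto_integral_of_dominated_convergence (fun x => ∑ t, g (x t))
      (fun n => (Finset.measurable_sum _ fun t _ =>
        (hγm n).comp (measurable_pi_apply t)).aestronglyMeasurable)
      (integrable_finsetSum _ fun t _ => hg1 t) (fun n => ae_of_all _ fun x => ?_)
      (ae_of_all _ fun x => tendsto_finsetSum _ fun t _ => tendsto_gridValue_gridCode (hg0 _))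
    rw [Real.norm_of_nonneg (sum_nonneg fun t _ => hγ0 n _)]
    exact sum_le_sum fun t _ => hγg n _
  exact le_of_tendsto (hlim.sub_const s) (Eventually.of_forall hbound)

end Main

/-! ### The lower-tail bound. -/

theorem mainTheorem7 {Ω : Type*} [MeasurableSpace Ω]
    (P : MeasureTheory.Measure Ω) [MeasureTheory.IsProbabilityMeasure P]
    {d : ℕ} (S : Set (EuclideanSpace ℝ (Fin d)))
    {T : ℕ} (hT : 0 < T)
    (X : Fin T → Ω → S) (hX : ∀ t, Measurable (X t))
    (C : ℝ) (hC : 0 < C) (α : ℝ) (hα : α ∈ Set.Icc (1 : ℝ) 2)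
    (g : S → ℝ) (hg : Measurable g) (hg_nonneg : ∀ x, 0 ≤ g x)
    (hg_int : ∀ t, MeasureTheory.Integrable (fun ω => g (X t ω) ^ 2) P)
    (hpos : α = 2 → 0 < ∑ t, ∫ ω, g (X t ω) ∂P)
    (hyper : ∫ ω, (1 / (T : ℝ)) * ∑ t, g (X t ω) ^ 2 ∂P
      ≤ C * (∫ ω, (1 / (T : ℝ)) * ∑ t, g (X t ω) ∂P) ^ α) :
    P.real {ω | ∑ t, g (X t ω) ≤ (1 / 2) * ∑ t, ∫ ω', g (X t ω') ∂P}
      ≤ Real.exp (-((T : ℝ) / (8 * C * matOpNorm (depMatrix (P.map fun ω t => X t ω)) ^ 2))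
          * ((1 / (T : ℝ)) * ∑ t, ∫ ω, g (X t ω) ∂P) ^ (2 - α)) := by
  open MeasureTheory in
  have hXm : Measurable fun ω t => X t ω := measurable_pi_lambda _ hX
  set μ := P.map fun ω t => X t ω with hμ
  have : IsProbabilityMeasure μ := Measure.isProbabilityMeasure_map hXm.aemeasurable
  have hgm : ∀ t, Measurable fun x : Fin T → S => g (x t) := fun t =>
    hg.comp (measurable_pi_apply t)
  have hsm : Measurable fun x : Fin T → S => ∑ t, g (x t) := Finset.measurable_sum _ fun t _ => hgm t
  have hs2m : Measurable fun x : Fin T → S => ∑ t, g (x t) ^ 2 :=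
    Finset.measurable_sum _ fun t _ => (hgm t).pow_const 2
  have hgi : ∀ t, Integrable (fun x : Fin T → S => g (x t) ^ 2) μ := fun t =>
    (integrable_map_measure ((hgm t).pow_const 2).aestronglyMeasurable hXm.aemeasurable).2
      (hg_int t)
  have hg1 : ∀ t, Integrable (fun ω => g (X t ω)) P := fun t =>
    ((memLp_two_iff_integrable_sq (hg.comp (hX t)).aestronglyMeasurable).2
      (hg_int t)).integrable one_le_two
  set G := ∑ t, ∫ ω, g (X t ω) ∂P with hG
  have hT' : (0 : ℝ) < T := Nat.cast_pos.2 hT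
  have hG0 : 0 ≤ G := Finset.sum_nonneg fun t _ => integral_nonneg fun ω => hg_nonneg _
  set m := (1 / (T : ℝ)) * G with hm
  have hGm : G = T * m := by rw [hm]; field_simp
  have hm0 : 0 ≤ m := by positivity
  have hIG : ∫ ω, ∑ t, g (X t ω) ∂P = G := integral_finsetSum _ fun t _ => hg1 t
  have hIμ : ∫ x, ∑ t, g (x t) ∂μ = G := by
    rw [hμ, integral_map hXm.aemeasurable hsm.aestronglyMeasurable, hIG]
  have hIμ2 : ∫ x, ∑ t, g (x t) ^ 2 ∂μ = ∫ ω, ∑ t, g (X t ω) ^ 2 ∂P := by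
    rw [hμ, integral_map hXm.aemeasurable hs2m.aestronglyMeasurable]
  set V := ∫ ω, ∑ t, g (X t ω) ^ 2 ∂P with hV
  have hV0 : 0 ≤ V := integral_nonneg fun ω => Finset.sum_nonneg fun t _ => sq_nonneg _
  rw [integral_const_mul, integral_const_mul, hIG, ← hV, ← hm] at hyper
  have hVle : V ≤ T * (C * m ^ α) := by
    rw [one_div, inv_mul_le_iff₀ hT'] at hyper
    exact hyper
  have hA : P.real {ω | ∑ t, g (X t ω) ≤ 1 / 2 * G} = μ.real {x | ∑ t, g (x t) ≤ 1 / 2 * G} := by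
    rw [hμ, map_measureReal_apply hXm (measurableSet_le hsm measurable_const)]
    rfl
  rw [hA]
  have hA0 : 0 ≤ μ.real {x | ∑ t, g (x t) ≤ 1 / 2 * G} := measureReal_nonneg
  -- A null event is set aside, since its logarithm would default to `0`.
  rcases hA0.eq_or_lt with h0 | h0
  · rw [← h0]
    exact (Real.exp_pos _).le
  have key := sum_integral_sub_le_matOpNorm_mul μ hg hg_nonneg hgi (1 / 2 * G) h0
  rw [hIμ, hIμ2] at key
  rw [← Real.log_le_iff_le_exp h0]
  have hL : 0 ≤ -Real.log (μ.real {x | ∑ t, g (x t) ≤ 1 / 2 * G}) :=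
    neg_nonneg.2 (Real.log_nonpos hA0 measureReal_le_one)
  generalize Real.log (μ.real {x | ∑ t, g (x t) ≤ 1 / 2 * G}) = ℓ at key hL ⊢
  set M := matOpNorm (depMatrix μ) with hM
  rw [neg_mul, le_neg, div_mul_eq_mul_div]
  refine div_le_of_le_mul₀ (by positivity) hL ?_
  rcases hm0.eq_or_lt with hm' | hm'
  -- For zero mean, `α < 2` makes the power `0` and the claim trivial; at `α = 2` it would be `0 ^ 0
  -- = 1`, which the positivity hypothesis excludes.
  · have hα2 : α ≠ 2 := fun h => by
      have := hpos h
      rw [hGm, ← hm', mul_zero] at this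
      exact lt_irrefl _ this
    rw [← hm', Real.zero_rpow (sub_ne_zero.2 hα2.symm), mul_zero]
    positivity
  have hsq : (1 / 2 * G) ^ 2 ≤ M ^ 2 * (2 * -ℓ) * V := by
    have h1 := pow_le_pow_left₀ (by linarith : 0 ≤ G - 1 / 2 * G) key 2
    rw [mul_pow, mul_pow, Real.sq_sqrt (by linarith), Real.sq_sqrt hV0] at h1
    calc (1 / 2 * G) ^ 2 = (G - 1 / 2 * G) ^ 2 := by ring
      _ ≤ _ := h1
  have hpow : m ^ 2 = m ^ α * m ^ (2 - α) := by
    rw [← Real.rpow_add hm', ← Real.rpow_natCast]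
    norm_num
  have hmα : 0 < m ^ α := Real.rpow_pos_of_pos hm' _
  have h2 : M ^ 2 * (2 * -ℓ) * V ≤ M ^ 2 * (2 * -ℓ) * (T * (C * m ^ α)) :=
    mul_le_mul_of_nonneg_left hVle (by positivity)
  -- The factor `T * m ^ α / 4` is common to `(T * m / 2)²` and the variance-type bound; the
  -- constant `8` is the `4` from halving the mean times the `2` before the entropy.
  have h3 : (T * m ^ α / 4) * (T * m ^ (2 - α)) ≤ (T * m ^ α / 4) * (-ℓ * (8 * C * M ^ 2)) := by
    calc _ = (1 / 2 * G) ^ 2 := by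
          rw [hGm]
          linear_combination (-(T : ℝ) ^ 2 / 4) * hpow
      _ ≤ _ := hsq.trans h2
      _ = _ := by ring
  exact le_of_mul_le_mul_left h3 (by positivity)
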